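/- Setting. Let $P$ be a probability distribution of $n$ random variables indexed by a finite set $V$, each with values in a finite alphabet $\Sigma$. Let $P$ be Markov with respect to a directed graph $G^*$ on $V$, i.e. $P=P_{G^*}$ where $P_G(x)=\prod_{v\in V}P(x_v\mid x_{\pi_G(v)})$ denotes the projection of $P$ onto $G$ and $\pi_G(v)$ the set of parents of $v$ in $G$. Let $G^*$ be a polytree (a directed acyclic graph whose skeleton, i.e. underlying undirected graph, is a forest) with maximum in-degree $d^*$. Let $d\ge d^*$, $\varepsilon>0$ and $0<C<1$. For sets of variables let $I(A;B)$ and $I(A;B\mid z)$ be the mutual information and conditional mutual information under $P$, and let $\hat I$ be the same quantities under the empirical distribution of a sample of size $m\ge 1$. Algorithm. Input: the skeleton of $G^*$, the number $d$, the threshold $C\varepsilon$, and $\hat I$. All edges are unoriented at first. At any time, $N(v)$ is the set of neighbours of $v$ in the skeleton, $N^{\mathrm{in}}(v)$ the set of those with an arc oriented into $v$ so far, and $N^{\mathrm{un}}(v)$ the set of those joined to $v$ by a still unoriented edge. Only unoriented edges are ever oriented. All loops over sets run in an arbitrary order. Phase 1. For $\gamma=d,d-1,\dots,2$, for every $v\in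 V$ and every $T\subseteq N(v)$ with $|T|=\gamma$: if $|T\cup N^{\mathrm{in}}(v)|\le d$ and $\hat I(u;T\setminus\{u\}\mid v)\ge C\varepsilon$ for all $u\in T$, orient $u\to v$ for all $u\in T$. Phase 2. Repeat the following two steps, until a repetition orients no edge. (a) If some $v$ has $|N^{\mathrm{in}}(v)|=d$ and $N^{\mathrm{un}}(v)\ne\emptyset$, choose such a $v$ and orient all its unoriented edges away from $v$ (Meek $R1(d)$). (b) For every $v\in V$ with $1\le|N^{\mathrm{in}}(v)|<d$ and every $u\in N^{\mathrm{un}}(v)$: if $\hat I(u;N^{\mathrm{in}}(v)\mid v)>C\varepsilon$ orient $u\to v$, else if $\hat I(u;N^{\mathrm{in}}(v))>C\varepsilon$ orient $v\to u$. (If $|N^{\mathrm{in}}(v)|$ reaches $d$ during the inner loop over $u$, the remaining $u$ may be either tested or skipped.) Phase 3. Let $H$ be the forest of the edges that are still unoriented, and orient it in any way such that it becomes a polytree of maximum in-degree at most $1$. The output $\hat G$ consists of these arcs and the arcs oriented before. Write $\pi(v)=\pi_{G^*}(v)$ and $\hat\pi(v)=\pi_{\hat G}(v)$. Lemma. Consider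 any run of the algorithm in which every test that is evaluated is correct at tolerance $\varepsilon$: whenever the run evaluates $\hat I(X;Y\mid Z)$ (with $Z$ a single variable or empty), it holds that (1) if $I(X;Y\mid Z)=0$, then $\hat I(X;Y\mid Z)<C\varepsilon$; (2) if $\hat I(X;Y\mid Z)\le C\varepsilon$, then $I(X;Y\mid Z)<\varepsilon$. Then the output $\hat G$ satisfies $$\sum_{v\in V} I(v;\pi(v))-\sum_{v\in V} I(v;\hat\pi(v))\le n\,(d^*+1)\,\varepsilon ,$$ and consequently $d_{\mathrm{KL}}(P\,\|\,P_{\hat G})\le n\,(d^*+1)\,\varepsilon$. -/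

import Mathlib

namespace PolytreeLearning

/-! ### Mutual information of finite-valued random variables -/

section Information

variable {Ω A B D : Type*}

/-- The probability `P(X = a)` of a random variable `X` under the distribution `p`. -/
noncomputable def prob (p : PMF Ω) (X : Ω → A) (a : A) : ℝ := (p.map X a).toReal

/-- `I(X;Y) = ∑ P(x,y) log (P(x,y) / (P(x) P(y)))`. -/
noncomputable def mutualInfo [Fintype A] [Fintype B] (p : PMF Ω) (X : Ω → A) (Y : Ω → B) : ℝ :=
  ∑ a : A, ∑ b : B,
    prob p (fun ω => (X ω, Y ω)) (a, b) *
      Real.log (prob p (fun ω => (X ω, Y ω)) (a, b) / (prob p X a * prob p Y b))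

/-- `I(X;Y|Z) = ∑ P(x,y,z) log (P(x,y,z) P(z) / (P(x,z) P(y,z)))`. -/
noncomputable def condMutualInfo [Fintype A] [Fintype B] [Fintype D]
    (p : PMF Ω) (X : Ω → A) (Y : Ω → B) (Z : Ω → D) : ℝ :=
  ∑ a : A, ∑ b : B, ∑ c : D,
    prob p (fun ω => (X ω, Y ω, Z ω)) (a, b, c) *
      Real.log (prob p (fun ω => (X ω, Y ω, Z ω)) (a, b, c) * prob p Z c /
        (prob p (fun ω => (X ω, Z ω)) (a, c) * prob p (fun ω => (Y ω, Z ω)) (b, c)))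

open Classical in
/-- `d_KL(p ‖ q) = ∑ p(x) log (p(x) / q(x))`, which is `⊤` when `q` vanishes at some point
where `p` does not. -/
noncomputable def klDivergence [Fintype Ω] (p q : Ω → ℝ) : EReal :=
  if ∀ x, q x = 0 → p x = 0 then ((∑ x : Ω, p x * Real.log (p x / q x) : ℝ) : EReal) else ⊤

/-- The empirical distribution of a sample of size `m`. -/
noncomputable def empirical {m : ℕ} [NeZero m] (x : Fin m → Ω) : PMF Ω :=
  (PMF.uniformOfFintype (Fin m)).map x

end Information

/-! ### Directed graphs and Bayesian networks -/

section Graphs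

variable {V : Type*}

/-- The undirected graph obtained by forgetting the orientation of every arc. -/
def skel (G : Digraph V) : SimpleGraph V := G.toSimpleGraphInclusive

/-- A polytree: a directed acyclic graph whose skeleton is a forest. -/
def IsPolytree (G : Digraph V) : Prop :=
  (∀ v, ¬ Relation.TransGen G.Adj v v) ∧ (skel G).IsAcyclic

open Classical in
/-- The set `π(v)` of parents of `v` in `G`. -/
noncomputable def parents [Fintype V] (G : Digraph V) (v : V) : Finset V :=
  Finset.univ.filter (fun u => G.Adj u v)

/-- The maximum in-degree of `G`. -/
noncomputable def maxInDegree [Fintype V] (G : Digraph V) : ℕ :=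
  Finset.univ.sup (fun v => (parents G v).card)

variable {α : Type*} [Fintype V] [DecidableEq V]

/-- The projection `P_G(x) = ∏ P(x_v | x_π(v))` of `P` onto `G`. -/
noncomputable def projection (P : PMF (V → α)) (G : Digraph V) (x : V → α) : ℝ :=
  ∏ v : V,
    prob P (fun ω => (ω v, (parents G v).restrict ω)) (x v, (parents G v).restrict x) /
      prob P (fun ω => (parents G v).restrict ω) ((parents G v).restrict x)

/-- `P` is Markov with respect to `G`, i.e. it factorises along `G`. -/
def IsMarkov (P : PMF (V → α)) (G : Digraph V) : Prop :=
  ∀ x, (P x).toReal = projection P G x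

variable [Fintype α]

/-- The mutual information `I(S;T)` of two sets of variables. -/
noncomputable def setInfo (P : PMF (V → α)) (S T : Finset V) : ℝ :=
  mutualInfo P (fun ω => S.restrict ω) (fun ω => T.restrict ω)

/-- The conditional mutual information `I(S;T|z)` of two sets of variables given a variable. -/
noncomputable def condSetInfo (P : PMF (V → α)) (S T : Finset V) (z : V) : ℝ :=
  condMutualInfo P (fun ω => S.restrict ω) (fun ω => T.restrict ω) (fun ω => ω z)

end Graphs

/-! ### (Conditional) mutual information tests -/

/-- A test concerns `I(X;Y|z)` (if `cond = some z`) or `I(X;Y)` (if `cond = none`). -/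
structure Test (V : Type*) where
  X : Finset V
  Y : Finset V
  cond : Option V

section Tests

variable {V α : Type*} [Fintype V] [DecidableEq V] [Fintype α]

/-- The value of the (conditional) mutual information that the test concerns, under `P`. -/
noncomputable def Test.info (t : Test V) (P : PMF (V → α)) : ℝ :=
  match t.cond with
  | none => setInfo P t.X t.Y
  | some z => condSetInfo P t.X t.Y z

/-- With `I` computed under the true distribution `P` and `Î` under the empirical one:
`I = 0` implies `Î < C ε`, and `Î ≤ C ε` implies `I < ε`. -/
def Test.IsCorrect (t : Test V) (P Phat : PMF (V → α)) (C ε : ℝ) : Prop :=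
  (t.info P = 0 → t.info Phat < C * ε) ∧ (t.info Phat ≤ C * ε → t.info P < ε)

end Tests

/-! ### The three-phase orientation algorithm -/

section Loops

variable {ι σ : Type*}

/-- Execute `body` for the members of a list, one after the other. -/
def ExecList (body : ι → σ → σ → Prop) : List ι → σ → σ → Prop
  | [], s, s' => s' = s
  | i :: l, s, s' => ∃ t, body i s t ∧ ExecList body l t s'

/-- A for-loop over a finite set, in an arbitrary order. -/
def ForEach (S : Finset ι) (body : ι → σ → σ → Prop) (s s' : σ) : Prop :=
  ∃ l : List ι, (l : Multiset ι) = S.val ∧ ExecList body l s s'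

end Loops

/-- A state of the algorithm: the arcs `(u, v)`, meaning `u → v`, oriented so far, and the tests
evaluated so far (a record only; the algorithm never looks at it). -/
structure State (V : Type*) where
  arcs : Finset (V × V)
  tests : Set (Test V)

section Algorithm

variable {V α : Type*} [Fintype V] [DecidableEq V] [Fintype α]

open Classical in
/-- The neighbours `N(v)` in the skeleton `K`. -/
noncomputable def nbrs (K : SimpleGraph V) (v : V) : Finset V :=
  Finset.univ.filter (fun u => K.Adj v u)

/-- The current incoming neighbours `N^in(v)`. -/
noncomputable def nIn (K : SimpleGraph V) (arcs : Finset (V × V)) (v : V) : Finset V :=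
  (nbrs K v).filter (fun u => (u, v) ∈ arcs)

/-- The currently unoriented neighbours `N^un(v)`. -/
noncomputable def nUn (K : SimpleGraph V) (arcs : Finset (V × V)) (v : V) : Finset V :=
  (nbrs K v).filter (fun u => (u, v) ∉ arcs ∧ (v, u) ∉ arcs)

/-- Orient `u → v` for every `u ∈ S` such that the edge `u - v` is unoriented. -/
noncomputable def orientInto (K : SimpleGraph V) (arcs : Finset (V × V)) (S : Finset V) (v : V) :
    Finset (V × V) :=
  arcs ∪ (S ∩ nUn K arcs v) ×ˢ {v}

/-- Orient `v → u` for every `u ∈ S` such that the edge `u - v` is unoriented. -/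
noncomputable def orientAway (K : SimpleGraph V) (arcs : Finset (V × V)) (v : V) (S : Finset V) :
    Finset (V × V) :=
  arcs ∪ {v} ×ˢ (S ∩ nUn K arcs v)

open Classical in
/-- Phase 1, body of the loops: if `|T ∪ N^in(v)| ≤ d` and `Î(u; T \ {u} | v) ≥ τ` for all
`u ∈ T`, orient `u → v` for all `u ∈ T`. -/
noncomputable def strongCheck (K : SimpleGraph V) (d : ℕ) (τ : ℝ) (Phat : PMF (V → α))
    (v : V) (T : Finset V) (s : State V) : State V :=
  if (T ∪ nIn K s.arcs v).card ≤ d then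
    { arcs :=
        if ∀ u ∈ T, τ ≤ Test.info ⟨{u}, T \ {u}, some v⟩ Phat then orientInto K s.arcs T v
        else s.arcs
      tests := s.tests ∪ {t | ∃ u ∈ T, t = ⟨{u}, T \ {u}, some v⟩} }
  else s

/-- Phase 1, one round: all `v`, all sets `T` of `γ` neighbours of `v`. -/
def Phase1Round (K : SimpleGraph V) (d : ℕ) (τ : ℝ) (Phat : PMF (V → α)) (γ : ℕ) :
    State V → State V → Prop :=
  ForEach Finset.univ fun v =>
    ForEach ((nbrs K v).powersetCard γ) fun T s s' => s' = strongCheck K d τ Phat v T s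

/-- Phase 1: rounds `γ, γ - 1, …, 2`. -/
def Phase1 (K : SimpleGraph V) (d : ℕ) (τ : ℝ) (Phat : PMF (V → α)) :
    ℕ → State V → State V → Prop
  | 0, s, s' => s' = s
  | 1, s, s' => s' = s
  | γ + 2, s, s' => ∃ t, Phase1Round K d τ Phat (γ + 2) s t ∧ Phase1 K d τ Phat (γ + 1) t s'

/-- Phase 2, Meek `R1(d)`: if some `v` has `d` incoming arcs and an unoriented edge, pick such a
`v` and orient its unoriented edges away from it. -/
def MeekStep (K : SimpleGraph V) (d : ℕ) (s s' : State V) : Prop :=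
  (∃ v, (nIn K s.arcs v).card = d ∧ (nUn K s.arcs v).Nonempty ∧
      s' = { arcs := orientAway K s.arcs v (nUn K s.arcs v), tests := s.tests }) ∨
    ((¬ ∃ v, (nIn K s.arcs v).card = d ∧ (nUn K s.arcs v).Nonempty) ∧ s' = s)

open Classical in
/-- Phase 2, local check of the edge `u - v`: if `Î(u; N^in(v) | v) > τ` orient `u → v`,
else if `Î(u; N^in(v)) > τ` orient `v → u`. -/
noncomputable def localCheck (K : SimpleGraph V) (τ : ℝ) (Phat : PMF (V → α)) (v u : V)
    (s : State V) : State V :=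
  let t₁ : Test V := ⟨{u}, nIn K s.arcs v, some v⟩
  let t₂ : Test V := ⟨{u}, nIn K s.arcs v, none⟩
  if τ < t₁.info Phat then
    { arcs := orientInto K s.arcs {u} v, tests := s.tests ∪ {t₁} }
  else if τ < t₂.info Phat then
    { arcs := orientAway K s.arcs v {u}, tests := s.tests ∪ {t₁, t₂} }
  else
    { arcs := s.arcs, tests := s.tests ∪ {t₁, t₂} }

/-- Phase 2, local search at `v`: if `1 ≤ |N^in(v)| < d`, check every `u ∈ N^un(v)`. Once `v` has
acquired `d` incoming arcs during this loop, both ways to run the rest of the loop are allowed: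
the guard may be re-evaluated (so that nothing more is tested at `v`), or not. -/
def LocalSearch (K : SimpleGraph V) (d : ℕ) (τ : ℝ) (Phat : PMF (V → α)) (v : V)
    (s s' : State V) : Prop :=
  if 1 ≤ (nIn K s.arcs v).card ∧ (nIn K s.arcs v).card < d then
    ForEach (nUn K s.arcs v)
      (fun u r r' => r' = localCheck K τ Phat v u r ∨ (d ≤ (nIn K r.arcs v).card ∧ r' = r)) s s'
  else s' = s

/-- Phase 2, one iteration of the do-while loop. -/
def Phase2Iter (K : SimpleGraph V) (d : ℕ) (τ : ℝ) (Phat : PMF (V → α)) (s s' : State V) : Prop :=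
  ∃ t, MeekStep K d s t ∧ ForEach Finset.univ (LocalSearch K d τ Phat) t s'

/-- Phase 2: iterate as long as new edges are being oriented. -/
inductive Phase2 (K : SimpleGraph V) (d : ℕ) (τ : ℝ) (Phat : PMF (V → α)) :
    State V → State V → Prop
  | halt {s s' : State V} : Phase2Iter K d τ Phat s s' → s'.arcs = s.arcs →
      Phase2 K d τ Phat s s'
  | again {s t s' : State V} : Phase2Iter K d τ Phat s t → t.arcs ≠ s.arcs →
      Phase2 K d τ Phat t s' → Phase2 K d τ Phat s s'

/-- The forest `H` of the unoriented edges. -/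
def unorientedGraph (K : SimpleGraph V) (arcs : Finset (V × V)) : SimpleGraph V :=
  SimpleGraph.fromRel (fun u v => u ∈ nUn K arcs v)

/-- Phase 3: orient `H` freely as a polytree of maximum in-degree at most one, and combine with
the arcs oriented before. -/
def Phase3 (K : SimpleGraph V) (arcs : Finset (V × V)) (Ghat : Digraph V) : Prop :=
  ∃ F : Digraph V, IsPolytree F ∧ skel F = unorientedGraph K arcs ∧ maxInDegree F ≤ 1 ∧
    ∀ u v, Ghat.Adj u v ↔ (u, v) ∈ arcs ∨ F.Adj u v

/-- `Ghat` is an output of the algorithm on the skeleton `K`, degree bound `d`, test threshold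
`τ = C ε` and empirical distribution `Phat`, for some way to resolve the choices that the
algorithm leaves open, and `tests` is the set of the tests that are evaluated in this run. -/
def IsOutput (K : SimpleGraph V) (d : ℕ) (τ : ℝ) (Phat : PMF (V → α))
    (Ghat : Digraph V) (tests : Set (Test V)) : Prop :=
  ∃ s₁ s₂ : State V, Phase1 K d τ Phat d ⟨∅, ∅⟩ s₁ ∧ Phase2 K d τ Phat s₁ s₂ ∧
    Phase3 K s₂.arcs Ghat ∧ tests = s₂.tests

end Algorithm

end PolytreeLearning

open PolytreeLearning

/-! Write π(v) for the true parents of v and N(v) for its incoming neighbours after Phase 2. Correct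
tests make every arc oriented in Phases 1 and 2 an arc of `G`. Given v, a child is independent of
the other neighbours of v (`condSetInfo_child_eq_zero`), so conditional dependence identifies a
parent. The parents of v are independent (`setInfo_parents_eq_zero`), so dependence on known parents
identifies a child. A vertex with d known parents has no others. Hence the output parents of v are
N(v) ⊆ π(v) and at most one further vertex w from Phase 3.

The loss is measured by `excess`, I(v;T) − ∑_{u∈T} I(u;v). Among true parents, adding u to T raises
it by I(u;T|v) ≥ 0. After Phase 1, each T ⊆ π(v) with at least two elements lies in N(v) or contains
some u with I(u;T∖u|v) < ε (`Phase1.dichotomy`). Peeling off such u costs at most d*ε in total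
(`excess_le`). The extra w costs at most ε, since I(w;N(v)) < ε once Phase 2 has halted
(`Phase2.setInfo_lt`). The remaining pairwise terms I(u;v) are symmetric and run over the same
unoriented edges for `G` and for Phase 3, so they cancel in the sum over v. This leaves (d*+1)ε per
vertex. The divergence bound follows because the divergence equals the difference of the two
information sums (`klDivergence_projection`, `IsMarkov.entropy_univ`). -/

namespace PolytreeLearning

/-! ### Entropy of finite random variables and nonnegativity of conditional mutual information. -/

section Entropy

variable {Ω A B D : Type*} [Fintype Ω]

open Classical in
theorem prob_eq_sum (p : PMF Ω) (X : Ω → A) (a : A) :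
    prob p X a = ∑ ω : Ω, if X ω = a then (p ω).toReal else 0 := by
  rw [prob, PMF.map_apply, tsum_fintype, ENNReal.toReal_sum]
  · refine Finset.sum_congr rfl fun ω _ => ?_
    by_cases h : X ω = a
    · simp [h]
    · simp [h, Ne.symm h]
  · intro ω _
    split_ifs
    · exact p.apply_ne_top ω
    · simp

theorem sum_prob_mul [Fintype A] (p : PMF Ω) (X : Ω → A) (F : A → ℝ) :
    ∑ a, prob p X a * F a = ∑ ω, (p ω).toReal * F (X ω) := by
  classical
  simp_rw [prob_eq_sum, Finset.sum_mul]
  rw [Finset.sum_comm]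
  refine Finset.sum_congr rfl fun ω _ => ?_
  simp [ite_mul]

theorem sum_toReal (p : PMF Ω) : ∑ ω, (p ω).toReal = 1 := by
  rw [← ENNReal.toReal_sum fun ω _ => p.apply_ne_top ω, ← tsum_fintype (L := .unconditional Ω),
    p.tsum_coe, ENNReal.toReal_one]

theorem sum_prob [Fintype A] (p : PMF Ω) (X : Ω → A) : ∑ a, prob p X a = 1 := by
  simpa [sum_toReal] using sum_prob_mul p X fun _ => 1

theorem prob_nonneg {Ω A : Type*} (p : PMF Ω) (X : Ω → A) (a : A) : 0 ≤ prob p X a := ENNReal.toReal_nonneg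

theorem le_prob (p : PMF Ω) (X : Ω → A) (ω : Ω) : (p ω).toReal ≤ prob p X (X ω) := by
  classical
  rw [prob_eq_sum]
  refine le_trans (le_of_eq ?_) (Finset.single_le_sum (fun ω' _ => ?_) (Finset.mem_univ ω))
  · simp
  · split_ifs <;> simp

theorem sum_prob_left [Fintype A] (p : PMF Ω) (X : Ω → A) (Y : Ω → B) (b : B) :
    ∑ a, prob p (fun ω => (X ω, Y ω)) (a, b) = prob p Y b := by
  classical
  simp_rw [prob_eq_sum]
  rw [Finset.sum_comm]
  refine Finset.sum_congr rfl fun ω _ => ?_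
  by_cases h : Y ω = b <;> simp [h]

/-- The Shannon entropy of a random variable on a finite probability space. -/
noncomputable def ent (p : PMF Ω) (X : Ω → A) : ℝ :=
  -∑ ω, (p ω).toReal * Real.log (prob p X (X ω))

/-- Entropy depends only on the partition of the sample space that the variable induces. This is how
tuples of restrictions are later identified with restrictions to unions. -/
theorem ent_congr (p : PMF Ω) {X : Ω → A} {Y : Ω → B}
    (h : ∀ ω ω', X ω = X ω' ↔ Y ω = Y ω') : ent p X = ent p Y := by
  classical
  simp_rw [ent, prob_eq_sum, h]

theorem mutualInfo_eq_ent [Fintype A] [Fintype B] (p : PMF Ω) (X : Ω → A) (Y : Ω → B) :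
    mutualInfo p X Y = ent p X + ent p Y - ent p fun ω => (X ω, Y ω) := by
  rw [mutualInfo, ← Fintype.sum_prod_type', ent, ent, ent]
  rw [sum_prob_mul p (fun ω => (X ω, Y ω)) fun c => Real.log
    (prob p (fun ω => (X ω, Y ω)) (c.1, c.2) / (prob p X c.1 * prob p Y c.2))]
  rw [← Finset.sum_neg_distrib, ← Finset.sum_neg_distrib, ← Finset.sum_neg_distrib,
    ← Finset.sum_add_distrib, ← Finset.sum_sub_distrib]
  refine Finset.sum_congr rfl fun ω _ => ?_
  rcases (ENNReal.toReal_nonneg (a := p ω)).eq_or_lt with h | h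
  · simp [← h]
  have h1 := (h.trans_le (le_prob p X ω)).ne'
  have h2 := (h.trans_le (le_prob p Y ω)).ne'
  have h3 := (h.trans_le (le_prob p (fun ω => (X ω, Y ω)) ω)).ne'
  rw [Real.log_div h3 (mul_ne_zero h1 h2), Real.log_mul h1 h2]
  ring

theorem condMutualInfo_eq_ent [Fintype A] [Fintype B] [Fintype D]
    (p : PMF Ω) (X : Ω → A) (Y : Ω → B) (Z : Ω → D) :
    condMutualInfo p X Y Z = ent p (fun ω => (X ω, Z ω)) + ent p (fun ω => (Y ω, Z ω)) -
      ent p (fun ω => (X ω, Y ω, Z ω)) - ent p Z := by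
  rw [condMutualInfo]
  simp_rw [← Fintype.sum_prod_type']
  rw [sum_prob_mul p (fun ω => (X ω, Y ω, Z ω)) fun c => Real.log
    (prob p (fun ω => (X ω, Y ω, Z ω)) (c.1, c.2.1, c.2.2) * prob p Z c.2.2 /
      (prob p (fun ω => (X ω, Z ω)) (c.1, c.2.2) * prob p (fun ω => (Y ω, Z ω)) (c.2.1, c.2.2)))]
  simp_rw [ent]
  rw [← Finset.sum_neg_distrib, ← Finset.sum_neg_distrib, ← Finset.sum_neg_distrib,
    ← Finset.sum_neg_distrib,
    ← Finset.sum_add_distrib, ← Finset.sum_sub_distrib, ← Finset.sum_sub_distrib]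
  refine Finset.sum_congr rfl fun ω _ => ?_
  rcases (ENNReal.toReal_nonneg (a := p ω)).eq_or_lt with h | h
  · simp [← h]
  have h1 := (h.trans_le (le_prob p Z ω)).ne'
  have h2 := (h.trans_le (le_prob p (fun ω => (X ω, Z ω)) ω)).ne'
  have h3 := (h.trans_le (le_prob p (fun ω => (Y ω, Z ω)) ω)).ne'
  have h4 := (h.trans_le (le_prob p (fun ω => (X ω, Y ω, Z ω)) ω)).ne'
  rw [Real.log_div (mul_ne_zero h4 h1) (mul_ne_zero h2 h3), Real.log_mul h4 h1, Real.log_mul h2 h3]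
  ring

/-- By log t ≥ 1 − 1/t, each summand is at least P(x,y,z) − P(x,z)P(y,z)/P(z). Both of these terms
sum to 1. -/
theorem condMutualInfo_nonneg [Fintype A] [Fintype B] [Fintype D]
    (p : PMF Ω) (X : Ω → A) (Y : Ω → B) (Z : Ω → D) : 0 ≤ condMutualInfo p X Y Z := by
  set r := prob p fun ω => (X ω, Y ω, Z ω) with hr
  set q := prob p fun ω => (X ω, Z ω) with hq
  set q' := prob p fun ω => (Y ω, Z ω) with hq'
  have key : ∀ a b c, r (a, b, c) - q (a, c) * q' (b, c) / prob p Z c ≤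
      r (a, b, c) * Real.log (r (a, b, c) * prob p Z c / (q (a, c) * q' (b, c))) := by
    intro a b c
    have hz := prob_nonneg p Z c
    have h1 : 0 ≤ q (a, c) := prob_nonneg _ _ _
    have h2 : 0 ≤ q' (b, c) := prob_nonneg _ _ _
    rcases (show 0 ≤ r (a, b, c) from prob_nonneg _ _ _).eq_or_lt with h | h
    · rw [← h]
      simp only [zero_mul, zero_sub, Left.neg_nonpos_iff]
      positivity
    -- A value of positive probability is attained at a point of positive mass, which makes all the
    -- marginals positive as well.
    obtain ⟨ω, hω, e⟩ : ∃ ω, 0 < (p ω).toReal ∧ (X ω, Y ω, Z ω) = (a, b, c) := by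
      classical
      rw [hr, prob_eq_sum] at h
      obtain ⟨ω, -, hω⟩ := Finset.exists_ne_zero_of_sum_ne_zero h.ne'
      split_ifs at hω with e
      · exact ⟨ω, ENNReal.toReal_nonneg.lt_of_ne' hω, e⟩
      · exact absurd rfl hω
    obtain ⟨rfl, rfl, rfl⟩ : X ω = a ∧ Y ω = b ∧ Z ω = c := by simpa using e
    have h1' : 0 < q (X ω, Z ω) := hω.trans_le (le_prob p (fun ω => (X ω, Z ω)) ω)
    have h2' : 0 < q' (Y ω, Z ω) := hω.trans_le (le_prob p (fun ω => (Y ω, Z ω)) ω)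
    have hz' : 0 < prob p Z (Z ω) := hω.trans_le (le_prob p Z ω)
    have hlog := Real.one_sub_inv_le_log_of_pos
      (show 0 < r (X ω, Y ω, Z ω) * prob p Z (Z ω) / (q (X ω, Z ω) * q' (Y ω, Z ω)) by positivity)
    refine le_trans (le_of_eq ?_) (mul_le_mul_of_nonneg_left hlog h.le)
    field_simp
  have hsum : ∑ a, ∑ b, ∑ c, (r (a, b, c) - q (a, c) * q' (b, c) / prob p Z c) = 0 := by
    simp_rw [Finset.sum_sub_distrib]
    have e1 : ∑ a, ∑ b, ∑ c, r (a, b, c) = 1 := by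
      simp_rw [← Fintype.sum_prod_type']
      exact sum_prob p fun ω => (X ω, Y ω, Z ω)
    have e2 : ∑ a, ∑ b, ∑ c, q (a, c) * q' (b, c) / prob p Z c = 1 := by
      calc ∑ a, ∑ b, ∑ c, q (a, c) * q' (b, c) / prob p Z c
          = ∑ c, (∑ a, q (a, c)) * (∑ b, q' (b, c)) / prob p Z c := by
            simp_rw [Finset.sum_mul_sum, Finset.sum_div]
            rw [Finset.sum_comm (s := (Finset.univ : Finset D))]
            exact Finset.sum_congr rfl fun a _ => Finset.sum_comm
        _ = ∑ c, prob p Z c := by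
            refine Finset.sum_congr rfl fun c _ => ?_
            -- The convention 0 / 0 = 0 covers values c of probability zero.
            rw [hq, hq', sum_prob_left, sum_prob_left, mul_self_div_self]
        _ = 1 := sum_prob p Z
    rw [e1, e2, sub_self]
  rw [← hsum]
  exact Finset.sum_le_sum fun a _ => Finset.sum_le_sum fun b _ => Finset.sum_le_sum fun c _ =>
    key a b c

end Entropy

/-! ### Joint entropies of sets of variables, submodularity, and the divergence of a projection. -/

section SetEntropy

variable {V α : Type*} [Fintype V] [DecidableEq V] [Fintype α]

/-- The joint entropy of a set of variables. -/
noncomputable def entropy (P : PMF (V → α)) (S : Finset V) : ℝ := ent P fun ω => S.restrict ω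

theorem restrict_eq_iff {V α : Type*} (S : Finset V) (x y : V → α) :
    S.restrict x = S.restrict y ↔ ∀ v ∈ S, x v = y v := by
  simp [funext_iff, Finset.restrict]

theorem setInfo_eq (P : PMF (V → α)) (S T : Finset V) :
    setInfo P S T = entropy P S + entropy P T - entropy P (S ∪ T) := by
  rw [setInfo, mutualInfo_eq_ent]
  congr 1
  refine ent_congr P fun ω ω' => ?_
  simp only [Prod.mk.injEq, restrict_eq_iff, Finset.mem_union]
  grind

theorem condSetInfo_eq (P : PMF (V → α)) (S T : Finset V) (z : V) :
    condSetInfo P S T z = entropy P (insert z S) + entropy P (insert z T) -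
      entropy P (insert z (S ∪ T)) - entropy P {z} := by
  rw [condSetInfo, condMutualInfo_eq_ent]
  congr 1
  · congr 1
    · congr 1 <;> refine ent_congr P fun ω ω' => ?_ <;>
        simp only [Prod.mk.injEq, restrict_eq_iff, Finset.mem_insert] <;> grind
    · refine ent_congr P fun ω ω' => ?_
      simp only [Prod.mk.injEq, restrict_eq_iff, Finset.mem_insert, Finset.mem_union]
      grind
  · refine ent_congr P fun ω ω' => ?_
    simp only [restrict_eq_iff, Finset.mem_singleton, forall_eq]

theorem entropy_empty (P : PMF (V → α)) : entropy P ∅ = 0 := by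
  simp [entropy, ent, prob_eq_sum, restrict_eq_iff, sum_toReal]

/-- This is I(S;T | S ∩ T) ≥ 0. -/
theorem entropy_submodular (P : PMF (V → α)) (S T : Finset V) :
    entropy P (S ∪ T) + entropy P (S ∩ T) ≤ entropy P S + entropy P T := by
  have h := condMutualInfo_nonneg P (fun ω => S.restrict ω) (fun ω => T.restrict ω)
    (fun ω => (S ∩ T).restrict ω)
  rw [condMutualInfo_eq_ent] at h
  have e1 : ent P (fun ω => (S.restrict ω, (S ∩ T).restrict ω)) = entropy P S := by
    refine ent_congr P fun ω ω' => ?_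
    simp only [Prod.mk.injEq, restrict_eq_iff, Finset.mem_inter]
    grind
  have e2 : ent P (fun ω => (T.restrict ω, (S ∩ T).restrict ω)) = entropy P T := by
    refine ent_congr P fun ω ω' => ?_
    simp only [Prod.mk.injEq, restrict_eq_iff, Finset.mem_inter]
    grind
  have e3 : ent P (fun ω => (S.restrict ω, T.restrict ω, (S ∩ T).restrict ω)) =
      entropy P (S ∪ T) := by
    refine ent_congr P fun ω ω' => ?_
    simp only [Prod.mk.injEq, restrict_eq_iff, Finset.mem_inter, Finset.mem_union]
    grind
  rw [e1, e2, e3] at h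
  unfold entropy at *
  linarith

/-- The conditional entropy of `v` given its parents in `G`. -/
noncomputable def parentEntropy (P : PMF (V → α)) (G : Digraph V) (v : V) : ℝ :=
  entropy P (insert v (parents G v)) - entropy P (parents G v)

theorem sum_log_projection (P : PMF (V → α)) (G : Digraph V) :
    ∑ x, (P x).toReal * Real.log (projection P G x) = -∑ v, parentEntropy P G v := by
  have e : ∀ v, entropy P (insert v (parents G v)) =
      ent P fun ω => (ω v, (parents G v).restrict ω) := by
    intro v
    refine ent_congr P fun ω ω' => ?_
    simp only [Prod.mk.injEq, restrict_eq_iff, Finset.mem_insert]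
    grind
  simp_rw [parentEntropy, e, entropy, ent]
  simp only [← Finset.sum_neg_distrib, ← Finset.sum_sub_distrib]
  rw [Finset.sum_comm]
  refine Finset.sum_congr rfl fun x _ => ?_
  rcases (ENNReal.toReal_nonneg (a := P x)).eq_or_lt with h | h
  · simp [← h]
  have h1 := fun v => (h.trans_le (le_prob P (fun ω => (ω v, (parents G v).restrict ω)) x)).ne'
  have h2 := fun v => (h.trans_le (le_prob P (fun ω => (parents G v).restrict ω) x)).ne'
  rw [projection, Real.log_prod fun v _ => div_ne_zero (h1 v) (h2 v), Finset.mul_sum]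
  refine Finset.sum_congr rfl fun v _ => ?_
  rw [Real.log_div (h1 v) (h2 v)]
  ring

theorem sum_log_self (P : PMF (V → α)) :
    ∑ x, (P x).toReal * Real.log (P x).toReal = -entropy P Finset.univ := by
  classical
  rw [entropy, ent, neg_neg]
  refine Finset.sum_congr rfl fun x _ => ?_
  congr 2
  rw [prob_eq_sum, Finset.sum_eq_single x]
  · simp
  · intro y _ hy
    rw [if_neg]
    rw [restrict_eq_iff]
    exact fun h => hy (funext fun v => h v (Finset.mem_univ v))
  · simp

theorem IsMarkov.entropy_univ {P : PMF (V → α)} {G : Digraph V} (hP : IsMarkov P G) :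
    entropy P Finset.univ = ∑ v, parentEntropy P G v := by
  have h := sum_log_projection P G
  simp_rw [← hP _, sum_log_self] at h
  linarith

/-- A projection of `P` is positive wherever `P` is, so the infinite case of the divergence never
occurs. -/
theorem klDivergence_projection (P : PMF (V → α)) (G : Digraph V) :
    klDivergence (fun x => (P x).toReal) (projection P G) =
      ((∑ v, parentEntropy P G v - entropy P Finset.univ : ℝ) : EReal) := by
  have hpos : ∀ x, 0 < (P x).toReal → projection P G x ≠ 0 := by
    intro x h
    exact Finset.prod_ne_zero_iff.2 fun v _ => div_ne_zero
      (h.trans_le (le_prob P (fun ω => (ω v, (parents G v).restrict ω)) x)).ne'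
      (h.trans_le (le_prob P (fun ω => (parents G v).restrict ω) x)).ne'
  have hsupp : ∀ x, projection P G x = 0 → (P x).toReal = 0 := by
    intro x hx
    by_contra h
    exact hpos x (ENNReal.toReal_nonneg.lt_of_ne' h) hx
  rw [klDivergence, if_pos hsupp]
  congr 1
  have h : ∀ x, (P x).toReal * Real.log ((P x).toReal / projection P G x) =
      (P x).toReal * Real.log (P x).toReal - (P x).toReal * Real.log (projection P G x) := by
    intro x
    rcases (ENNReal.toReal_nonneg (a := P x)).eq_or_lt with h | h
    · simp [← h]
    · rw [Real.log_div h.ne' (hpos x h)]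
      ring
  simp_rw [h, Finset.sum_sub_distrib, sum_log_projection, sum_log_self]
  ring

end SetEntropy

/-! ### Polytrees and edge cuts in forests. -/

section Forest

variable {V : Type*}

theorem skel_adj {G : Digraph V} {u v : V} :
    (skel G).Adj u v ↔ u ≠ v ∧ (G.Adj u v ∨ G.Adj v u) := Iff.rfl

theorem IsPolytree.ne {G : Digraph V} (hG : IsPolytree G) {u v : V} (h : G.Adj u v) : u ≠ v := by
  rintro rfl
  exact hG.1 u (.single h)

theorem IsPolytree.not_adj_symm {G : Digraph V} (hG : IsPolytree G) {u v : V} (h : G.Adj u v) :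
    ¬ G.Adj v u := fun h' => hG.1 u (.tail (.single h) h')

theorem IsPolytree.skel_adj {G : Digraph V} (hG : IsPolytree G) {u v : V} :
    (skel G).Adj u v ↔ G.Adj u v ∨ G.Adj v u := by
  rw [PolytreeLearning.skel_adj, and_iff_right_iff_imp]
  rintro (h | h)
  exacts [hG.ne h, (hG.ne h).symm]

theorem mem_parents [Fintype V] {G : Digraph V} {u v : V} : u ∈ parents G v ↔ G.Adj u v := by
  simp [parents]

theorem card_parents_le [Fintype V] (G : Digraph V) (v : V) :
    (parents G v).card ≤ maxInDegree G :=
  Finset.le_sup (f := fun v => (parents G v).card) (Finset.mem_univ v)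

/-- Removing the edge `u - v` of a forest separates `u` from `v`. -/
theorem exists_side [Fintype V] {K : SimpleGraph V} (hK : K.IsAcyclic) {u v : V} (h : K.Adj u v) :
    ∃ C : Finset V, u ∈ C ∧ v ∉ C ∧
      (∀ a ∈ C, ∀ b ∉ C, K.Adj a b → a = u ∧ b = v) := by
  classical
  refine ⟨Finset.univ.filter fun w => (K.deleteEdges {s(u, v)}).Reachable u w, ?_, ?_, ?_⟩
  · simp
  · simpa using SimpleGraph.isBridge_iff.1 (SimpleGraph.isAcyclic_iff_forall_adj_isBridge.1 hK h)
  · intro a ha b hb hab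
    simp only [Finset.mem_filter, Finset.mem_univ, true_and] at ha hb
    have hv := SimpleGraph.isBridge_iff.1 (SimpleGraph.isAcyclic_iff_forall_adj_isBridge.1 hK h)
    by_contra hne
    by_cases he : s(a, b) = s(u, v)
    · rw [Sym2.eq_iff] at he
      rcases he with he | ⟨rfl, rfl⟩
      · exact hne he
      · exact hv ha
    · exact hb (ha.trans (SimpleGraph.Adj.reachable
        (by rw [SimpleGraph.deleteEdges_adj]; exact ⟨hab, by simpa using he⟩)))

end Forest

/-! ### Independence statements read off from a Markov polytree. -/

section Separation

variable {V α : Type*} [Fintype V] [DecidableEq V] [Fintype α]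

/-- Chain rule as an inequality: remove a vertex of D without children in D and apply submodularity
to the rest and its parent family. The Markov property gives equality on the whole vertex set, which
forces such bounds to be tight when combined. -/
theorem entropy_le_add_sum_parentEntropy (P : PMF (V → α)) {G : Digraph V} (hG : IsPolytree G)
    {A D : Finset V} (hAD : Disjoint A D) (hpar : ∀ w ∈ D, parents G w ⊆ A ∪ D) :
    entropy P (A ∪ D) ≤ entropy P A + ∑ w ∈ D, parentEntropy P G w := by
  induction hn : D.card generalizing D with
  | zero =>
    rw [Finset.card_eq_zero] at hn
    simp [hn]
  | succ n ih =>
    have hD : D.Nonempty := Finset.card_pos.1 (by omega)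
    have : Std.Irrefl (Function.swap (Relation.TransGen G.Adj)) := ⟨hG.1⟩
    have : IsTrans V (Function.swap (Relation.TransGen G.Adj)) := ⟨fun _ _ _ h h' => h'.trans h⟩
    -- Minimality for the reversed ancestor relation: w has no proper descendant in D.
    obtain ⟨w, hw, hmax⟩ :=
      (Finite.wellFounded_of_trans_of_irrefl (Function.swap (Relation.TransGen G.Adj))).has_min
        (D : Set V) hD
    have hw : w ∈ D := hw
    have hnc : ∀ w' ∈ D, ¬ G.Adj w w' := fun w' hw' h => hmax w' hw' (.single h)
    have ih := ih (D := D.erase w) (hAD.mono_right (Finset.erase_subset _ _)) (by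
      intro w' hw' x hx
      have hw' := Finset.mem_of_mem_erase hw'
      have hx' := hpar w' hw' hx
      have hxw : x ≠ w := fun e => hnc w' hw' (e ▸ mem_parents.1 hx)
      rw [Finset.mem_union] at hx' ⊢
      exact hx'.imp_right (Finset.mem_erase.2 ⟨hxw, ·⟩)) (by rw [Finset.card_erase_of_mem hw, hn]; rfl)
    have hsub := entropy_submodular P (A ∪ D.erase w) (insert w (parents G w))
    have hww : w ∉ parents G w := fun h => hG.ne (mem_parents.1 h) rfl
    have hwA : w ∉ A := Finset.disjoint_right.1 hAD hw
    have hp := hpar w hw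
    rw [show A ∪ D.erase w ∪ insert w (parents G w) = A ∪ D by grind,
      show (A ∪ D.erase w) ∩ insert w (parents G w) = parents G w by grind] at hsub
    rw [← Finset.add_sum_erase D _ hw]
    unfold parentEntropy at *
    linarith

variable {P : PMF (V → α)} {G : Digraph V}

theorem condSetInfo_nonneg (P : PMF (V → α)) (S T : Finset V) (z : V) :
    0 ≤ condSetInfo P S T z := condMutualInfo_nonneg _ _ _ _

theorem setInfo_nonneg (P : PMF (V → α)) {S T : Finset V} (h : Disjoint S T) :
    0 ≤ setInfo P S T := by
  have := entropy_submodular P S T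
  rw [Finset.disjoint_iff_inter_eq_empty.1 h, entropy_empty] at this
  rw [setInfo_eq]
  linarith

/-- Submodularity twice; disjointness makes the two intersections exactly S and T. -/
theorem setInfo_mono (P : PMF (V → α)) {S S' T T' : Finset V} (hS : S ⊆ S') (hT : T ⊆ T')
    (h : Disjoint S' T') : setInfo P S T ≤ setInfo P S' T' := by
  have hd := Finset.disjoint_left.1 h
  have h1 := entropy_submodular P S' (S ∪ T)
  have h2 := entropy_submodular P T' (S' ∪ T)
  rw [show S' ∪ (S ∪ T) = S' ∪ T by grind, show S' ∩ (S ∪ T) = S by grind] at h1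
  rw [show T' ∪ (S' ∪ T) = S' ∪ T' by grind, show T' ∩ (S' ∪ T) = T by grind] at h2
  rw [setInfo_eq, setInfo_eq]
  linarith

/-- Given `v`, a child of `v` is independent of the other neighbours of `v`. -/
theorem condSetInfo_child_eq_zero (hG : IsPolytree G) (hP : IsMarkov P G) {u v : V}
    (huv : G.Adj v u) {T : Finset V} (hT : ∀ t ∈ T, (skel G).Adj v t) (huT : u ∉ T) :
    condSetInfo P {u} T v = 0 := by
  refine le_antisymm ?_ (condSetInfo_nonneg _ _ _ _)
  obtain ⟨C, huC, hvC, hC⟩ := exists_side hG.2 (hG.skel_adj.2 (.inr huv))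
  have hTC : ∀ t ∈ T, t ∉ C := by
    intro t ht htC
    have := (hC t htC v hvC (hT t ht).symm).1
    exact huT (this ▸ ht)
  -- The only edge across the cut is v → u, so the complement of C is closed under parents and C
  -- only needs v in addition. With the Markov identity this gives I(C; Cᶜ | v) ≤ 0 in entropy form;
  -- `h4` and `h5` then shrink the two sides to u and T.
  have h1 := entropy_le_add_sum_parentEntropy P hG (A := ∅) (D := Cᶜ) (by simp) (by
    intro w hw x hx
    rw [Finset.mem_compl] at hw
    rw [Finset.empty_union, Finset.mem_compl]
    intro hxC
    have hxw := mem_parents.1 hx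
    obtain ⟨rfl, rfl⟩ := hC x hxC w hw (hG.skel_adj.2 (.inl hxw))
    exact hG.not_adj_symm huv hxw)
  have h2 := entropy_le_add_sum_parentEntropy P hG (A := {v}) (D := C) (by simpa using hvC) (by
    intro w hw x hx
    by_cases hxC : x ∈ C
    · simp [hxC]
    · have := (hC w hw x hxC (hG.skel_adj.2 (.inr (mem_parents.1 hx)))).2
      simp [this])
  have h3 := hP.entropy_univ
  rw [← Finset.sum_add_sum_compl C] at h3
  rw [Finset.empty_union, entropy_empty] at h1
  have h4 := entropy_submodular P ({v} ∪ C) (insert u Cᶜ)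
  have h5 := entropy_submodular P Cᶜ (insert v ({u} ∪ T))
  rw [show ({v} ∪ C) ∪ (insert u Cᶜ) = Finset.univ by ext; grind [Finset.mem_compl],
    show ({v} ∪ C) ∩ (insert u Cᶜ) = {v, u} by ext; grind [Finset.mem_compl]] at h4
  rw [show Cᶜ ∪ insert v ({u} ∪ T) = insert u Cᶜ by ext; grind [Finset.mem_compl],
    show Cᶜ ∩ insert v ({u} ∪ T) = insert v T by ext; grind [Finset.mem_compl]] at h5
  rw [condSetInfo_eq]
  linarith

/-- The parents of `v` are independent. -/
theorem setInfo_parents_eq_zero (hG : IsPolytree G) (hP : IsMarkov P G) {u v : V}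
    (huv : G.Adj u v) {S : Finset V} (hS : S ⊆ parents G v) (huS : u ∉ S) :
    setInfo P {u} S = 0 := by
  classical
  refine le_antisymm ?_ (setInfo_nonneg P (by simpa using huS))
  obtain ⟨C, huC, hvC, hC⟩ := exists_side hG.2 (hG.skel_adj.2 (.inl huv))
  -- D consists of v and its descendants. Its complement is closed under parents, and so are the two
  -- pieces into which C cuts it, because the only crossing edge u → v ends in D. The Markov
  -- identity then makes the two pieces independent.
  obtain ⟨D, hD⟩ : ∃ D : Finset V, ∀ w, w ∈ D ↔ Relation.ReflTransGen G.Adj v w :=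
    ⟨Finset.univ.filter fun w => Relation.ReflTransGen G.Adj v w, by simp⟩
  have hpar : ∀ w ∉ D, ∀ x, G.Adj x w → x ∉ D := fun w hw x hx hxD =>
    hw ((hD w).2 (((hD x).1 hxD).tail hx))
  have hvD : v ∈ D := (hD v).2 .refl
  have hpD : ∀ x, G.Adj x v → x ∉ D := fun x hx hxD =>
    hG.1 v (Relation.TransGen.tail' ((hD x).1 hxD) hx)
  have hU : Dᶜ ∪ D = Finset.univ := by rw [Finset.union_comm, Finset.union_compl]
  have h1 := entropy_le_add_sum_parentEntropy P hG (A := Dᶜ) (D := D)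
    disjoint_compl_left fun w _ => by simp [hU]
  have h2 := entropy_le_add_sum_parentEntropy P hG (A := ∅) (D := Dᶜ ∩ C) (by simp) (by
    intro w hw x hx
    have hxw := mem_parents.1 hx
    simp only [Finset.empty_union, Finset.mem_inter, Finset.mem_compl] at hw ⊢
    refine ⟨hpar w hw.1 x hxw, ?_⟩
    by_contra hxC
    obtain ⟨rfl, rfl⟩ := hC w hw.2 x hxC (hG.skel_adj.2 (.inr hxw))
    exact hG.not_adj_symm huv hxw)
  have h3 := entropy_le_add_sum_parentEntropy P hG (A := ∅) (D := Dᶜ \ C) (by simp) (by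
    intro w hw x hx
    have hxw := mem_parents.1 hx
    simp only [Finset.empty_union, Finset.mem_sdiff, Finset.mem_compl] at hw ⊢
    refine ⟨hpar w hw.1 x hxw, fun hxC => hw.1 ?_⟩
    obtain ⟨rfl, rfl⟩ := hC x hxC w hw.2 (hG.skel_adj.2 (.inl hxw))
    exact hvD)
  have h4 := hP.entropy_univ
  rw [← Finset.sum_add_sum_compl D, ← Finset.sum_inter_add_sum_sdiff Dᶜ C] at h4
  rw [hU] at h1
  rw [Finset.empty_union, entropy_empty] at h2 h3
  have h5 : setInfo P (Dᶜ ∩ C) (Dᶜ \ C) ≤ 0 := by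
    rw [setInfo_eq, show Dᶜ ∩ C ∪ Dᶜ \ C = Dᶜ by ext; grind [Finset.mem_compl]]
    linarith
  refine (setInfo_mono P (by simpa using ⟨hpD u huv, huC⟩) (fun x hx => ?_)
    (by rw [Finset.disjoint_left]; grind)).trans h5
  have hxv := mem_parents.1 (hS hx)
  simp only [Finset.mem_sdiff, Finset.mem_compl]
  refine ⟨hpD x hxv, fun hxC => huS ?_⟩
  rw [← (hC x hxC v hvC (hG.skel_adj.2 (.inl hxv))).1]
  exact hx

end Separation

/-! ### Invariants of loops run in arbitrary order. -/

section Loops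

variable {ι σ : Type*} {R : σ → σ → Prop} {body : ι → σ → σ → Prop}

theorem ExecList.rel (hrefl : ∀ s, R s s) (htrans : ∀ r s t, R r s → R s t → R r t)
    {l : List ι} (hbody : ∀ i ∈ l, ∀ s s', body i s s' → R s s') {s s' : σ}
    (h : ExecList body l s s') : R s s' := by
  induction l generalizing s with
  | nil => exact h ▸ hrefl _
  | cons i l ih =>
    obtain ⟨t, h1, h2⟩ := h
    exact htrans _ _ _ (hbody i (by simp) _ _ h1) (ih (fun j hj => hbody j (by simp [hj])) h2)

/-- Isolates the moment at which a given index is processed, with `R` linking it to the start and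
the end, so the order of the loop is irrelevant. -/
theorem ExecList.exists_step (hrefl : ∀ s, R s s) (htrans : ∀ r s t, R r s → R s t → R r t)
    {l : List ι} (hbody : ∀ i ∈ l, ∀ s s', body i s s' → R s s') {s s' : σ}
    (h : ExecList body l s s') {i : ι} (hi : i ∈ l) :
    ∃ t t', R s t ∧ body i t t' ∧ R t' s' := by
  induction l generalizing s with
  | nil => simp at hi
  | cons j l ih =>
    obtain ⟨t, h1, h2⟩ := h
    have hl := fun k (hk : k ∈ l) => hbody k (List.mem_cons_of_mem _ hk)
    rcases List.mem_cons.1 hi with rfl | hi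
    · exact ⟨s, t, hrefl s, h1, h2.rel hrefl htrans hl⟩
    · obtain ⟨r, r', h3, h4, h5⟩ := ih hl h2 hi
      exact ⟨r, r', htrans _ _ _ (hbody j (by simp) _ _ h1) h3, h4, h5⟩

theorem ForEach.rel (hrefl : ∀ s, R s s) (htrans : ∀ r s t, R r s → R s t → R r t)
    {S : Finset ι} (hbody : ∀ i ∈ S, ∀ s s', body i s s' → R s s') {s s' : σ}
    (h : ForEach S body s s') : R s s' := by
  obtain ⟨l, hl, h⟩ := h
  refine h.rel hrefl htrans fun i hi => hbody i ?_
  rwa [← Finset.mem_val, ← hl]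

theorem ForEach.exists_step (hrefl : ∀ s, R s s) (htrans : ∀ r s t, R r s → R s t → R r t)
    {S : Finset ι} (hbody : ∀ i ∈ S, ∀ s s', body i s s' → R s s') {s s' : σ}
    (h : ForEach S body s s') {i : ι} (hi : i ∈ S) :
    ∃ t t', R s t ∧ body i t t' ∧ R t' s' := by
  obtain ⟨l, hl, h⟩ := h
  have hmem : ∀ j, j ∈ l ↔ j ∈ S := fun j => by rw [← Finset.mem_val, ← hl, Multiset.mem_coe]
  exact h.exists_step hrefl htrans (fun j hj => hbody j ((hmem j).1 hj)) ((hmem i).2 hi)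

end Loops

/-! ### Monotonicity and conditional soundness of parts of a run. -/

section Progress

variable {V : Type*}

/-- Every arc oriented so far is an arc of `G`. -/
def Sound (G : Digraph V) (arcs : Finset (V × V)) : Prop := ∀ e ∈ arcs, G.Adj e.1 e.2

/-- The effect of a part of a run: arcs and tests are only ever added, and the new arcs are arcs
of `G` provided that the tests have the property `ok`. -/
structure Progress (G : Digraph V) (ok : Test V → Prop) (s s' : State V) : Prop where
  arcs : s.arcs ⊆ s'.arcs
  tests : s.tests ⊆ s'.tests
  sound : (∀ t ∈ s'.tests, ok t) → Sound G s.arcs → Sound G s'.arcs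

theorem Progress.refl {G : Digraph V} {ok : Test V → Prop} (s : State V) : Progress G ok s s :=
  ⟨subset_rfl, subset_rfl, fun _ h => h⟩

theorem Progress.trans {G : Digraph V} {ok : Test V → Prop} (r s t : State V)
    (h : Progress G ok r s) (h' : Progress G ok s t) : Progress G ok r t :=
  ⟨h.arcs.trans h'.arcs, h.tests.trans h'.tests,
    fun ht hr => h'.sound ht (h.sound (fun t hts => ht t (h'.tests hts)) hr)⟩

end Progress

/-! ### Soundness of the oriented arcs, and what Phases 1 and 2 achieve. -/

section Algorithm

variable {V α : Type*} [Fintype V] [DecidableEq V] [Fintype α]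

theorem mem_nbrs {V : Type*} [Fintype V] {K : SimpleGraph V} {u v : V} : u ∈ nbrs K v ↔ K.Adj v u := by simp [nbrs]

theorem mem_nIn {K : SimpleGraph V} {arcs : Finset (V × V)} {u v : V} :
    u ∈ nIn K arcs v ↔ K.Adj v u ∧ (u, v) ∈ arcs := by simp [nIn, mem_nbrs]

theorem mem_nUn {K : SimpleGraph V} {arcs : Finset (V × V)} {u v : V} :
    u ∈ nUn K arcs v ↔ K.Adj v u ∧ (u, v) ∉ arcs ∧ (v, u) ∉ arcs := by simp [nUn, mem_nbrs]

theorem mem_orientInto {K : SimpleGraph V} {arcs : Finset (V × V)} {S : Finset V} {v : V}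
    {e : V × V} :
    e ∈ orientInto K arcs S v ↔ e ∈ arcs ∨ (e.1 ∈ S ∧ e.1 ∈ nUn K arcs v) ∧ e.2 = v := by
  simp only [orientInto, Finset.mem_union, Finset.mem_product, Finset.mem_inter,
    Finset.mem_singleton]

theorem mem_orientAway {K : SimpleGraph V} {arcs : Finset (V × V)} {S : Finset V} {v : V}
    {e : V × V} :
    e ∈ orientAway K arcs v S ↔ e ∈ arcs ∨ e.1 = v ∧ e.2 ∈ S ∧ e.2 ∈ nUn K arcs v := by
  simp only [orientAway, Finset.mem_union, Finset.mem_product, Finset.mem_inter,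
    Finset.mem_singleton]

theorem Sound.nIn_subset {G : Digraph V} {arcs : Finset (V × V)} (h : Sound G arcs) (v : V) :
    nIn (skel G) arcs v ⊆ parents G v := fun _ hu => mem_parents.2 (h _ (mem_nIn.1 hu).2)

theorem Sound.card_nIn_le {G : Digraph V} {arcs : Finset (V × V)} (h : Sound G arcs) (v : V) :
    (nIn (skel G) arcs v).card ≤ maxInDegree G :=
  (Finset.card_le_card (h.nIn_subset v)).trans (card_parents_le G v)

variable {G : Digraph V} {P Phat : PMF (V → α)} {C ε : ℝ} {d : ℕ}

theorem adj_of_test_cond (hG : IsPolytree G) (hP : IsMarkov P G) {u v : V} {T : Finset V}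
    (hu : (skel G).Adj v u) (hT : ∀ t ∈ T, (skel G).Adj v t) (huT : u ∉ T)
    (hok : Test.IsCorrect ⟨{u}, T, some v⟩ P Phat C ε)
    (h : C * ε ≤ Test.info ⟨{u}, T, some v⟩ Phat) : G.Adj u v := by
  refine (hG.skel_adj.1 hu).resolve_left fun hvu => ?_
  exact (hok.1 (condSetInfo_child_eq_zero hG hP hvu hT huT)).not_ge h

theorem adj_of_test_none (hG : IsPolytree G) (hP : IsMarkov P G) {u v : V} {T : Finset V}
    (hu : (skel G).Adj v u) (hT : T ⊆ parents G v) (huT : u ∉ T)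
    (hok : Test.IsCorrect ⟨{u}, T, none⟩ P Phat C ε)
    (h : C * ε ≤ Test.info ⟨{u}, T, none⟩ Phat) : G.Adj v u := by
  refine (hG.skel_adj.1 hu).resolve_right fun huv => ?_
  exact (hok.1 (setInfo_parents_eq_zero hG hP huv hT huT)).not_ge h

theorem strongCheck_progress (hG : IsPolytree G) (hP : IsMarkov P G) (v : V) {T : Finset V}
    (hT : T ⊆ nbrs (skel G) v) (s : State V) :
    Progress G (fun t => t.IsCorrect P Phat C ε) s
      (strongCheck (skel G) d (C * ε) Phat v T s) := by
  unfold strongCheck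
  split_ifs with h1 h2
  · refine ⟨Finset.subset_union_left, Set.subset_union_left, fun hok hs e he => ?_⟩
    rcases mem_orientInto.1 he with he | ⟨⟨heT, he⟩, rfl⟩
    · exact hs e he
    · refine adj_of_test_cond hG hP (mem_nUn.1 he).1
        (fun t ht => mem_nbrs.1 (hT ((Finset.mem_sdiff.1 ht).1))) (by simp)
        (hok _ (.inr ⟨_, heT, rfl⟩)) (h2 _ heT)
  · exact ⟨subset_rfl, Set.subset_union_left, fun _ h => h⟩
  · exact Progress.refl s

theorem localCheck_progress (hG : IsPolytree G) (hP : IsMarkov P G) (v u : V) (s : State V) :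
    Progress G (fun t => t.IsCorrect P Phat C ε) s
      (localCheck (skel G) (C * ε) Phat v u s) := by
  have hnbrs : ∀ t ∈ nIn (skel G) s.arcs v, (skel G).Adj v t := fun t ht => (mem_nIn.1 ht).1
  have hnot : ∀ u ∈ nUn (skel G) s.arcs v, u ∉ nIn (skel G) s.arcs v :=
    fun u hu hu' => (mem_nUn.1 hu).2.1 (mem_nIn.1 hu').2
  unfold localCheck
  dsimp only
  split_ifs with h1 h2
  · refine ⟨Finset.subset_union_left, Set.subset_union_left, fun hok hs e he => ?_⟩
    rcases mem_orientInto.1 he with he | ⟨⟨heu, hun⟩, rfl⟩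
    · exact hs e he
    · obtain rfl := Finset.mem_singleton.1 heu
      exact adj_of_test_cond hG hP (mem_nUn.1 hun).1 hnbrs (hnot _ hun) (hok _ (.inr rfl)) h1.le
  · refine ⟨Finset.subset_union_left, Set.subset_union_left, fun hok hs e he => ?_⟩
    rcases mem_orientAway.1 he with he | ⟨rfl, heu, hun⟩
    · exact hs e he
    · obtain rfl := Finset.mem_singleton.1 heu
      -- Unlike the conditional test, which only needs neighbours of v, the marginal test needs the
      -- known incoming neighbours to be true parents; this is the soundness of the current arcs.
      exact adj_of_test_none hG hP (mem_nUn.1 hun).1 (hs.nIn_subset _) (hnot _ hun)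
        (hok _ (.inr (.inr rfl))) h2.le
  · exact ⟨subset_rfl, Set.subset_union_left, fun _ h => h⟩

theorem LocalSearch.progress (hG : IsPolytree G) (hP : IsMarkov P G) {v : V} {s s' : State V}
    (h : LocalSearch (skel G) d (C * ε) Phat v s s') :
    Progress G (fun t => t.IsCorrect P Phat C ε) s s' := by
  unfold LocalSearch at h
  split_ifs at h
  · refine h.rel Progress.refl Progress.trans fun u _ r r' hr => ?_
    rcases hr with rfl | ⟨-, rfl⟩
    · exact localCheck_progress hG hP v u r
    · exact Progress.refl r'
  · exact h ▸ Progress.refl s'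

/-- By soundness and the in-degree bound, d incoming arcs already exhaust the parents of v, so the
other edges leave v. No test is involved, hence `ok` is arbitrary. -/
theorem MeekStep.progress (hG : IsPolytree G) (hd : maxInDegree G ≤ d) (ok : Test V → Prop)
    {s s' : State V} (h : MeekStep (skel G) d s s') : Progress G ok s s' := by
  rcases h with ⟨v, hv, -, rfl⟩ | ⟨-, rfl⟩
  · refine ⟨Finset.subset_union_left, subset_rfl, fun _ hs e he => ?_⟩
    rcases mem_orientAway.1 he with he | ⟨rfl, -, he⟩
    · exact hs e he
    · have heq := Finset.eq_of_subset_of_card_le (hs.nIn_subset e.1)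
        (((card_parents_le G _).trans hd).trans hv.ge)
      refine (hG.skel_adj.1 (mem_nUn.1 he).1).resolve_right fun h => ?_
      rw [← mem_parents, ← heq] at h
      exact (mem_nUn.1 he).2.1 (mem_nIn.1 h).2
  · exact Progress.refl s'

theorem Phase1Round.progress (hG : IsPolytree G) (hP : IsMarkov P G) {γ : ℕ} {s s' : State V}
    (h : Phase1Round (skel G) d (C * ε) Phat γ s s') :
    Progress G (fun t => t.IsCorrect P Phat C ε) s s' :=
  ForEach.rel Progress.refl Progress.trans (fun v _ _ _ h' =>
    h'.rel Progress.refl Progress.trans fun _ hT r _ hr =>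
      hr ▸ strongCheck_progress hG hP v (Finset.mem_powersetCard.1 hT).1 r) h

theorem Phase1.progress (hG : IsPolytree G) (hP : IsMarkov P G) : ∀ {γ : ℕ} {s s' : State V},
    Phase1 (skel G) d (C * ε) Phat γ s s' → Progress G (fun t => t.IsCorrect P Phat C ε) s s'
  | 0, _, _, h => h ▸ Progress.refl _
  | 1, _, _, h => h ▸ Progress.refl _
  | γ + 2, _, _, ⟨_, h1, h2⟩ =>
    Progress.trans _ _ _ (h1.progress hG hP) (Phase1.progress hG hP (γ := γ + 1) h2)

theorem Phase2Iter.progress (hG : IsPolytree G) (hP : IsMarkov P G) (hd : maxInDegree G ≤ d)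
    {s s' : State V} (h : Phase2Iter (skel G) d (C * ε) Phat s s') :
    Progress G (fun t => t.IsCorrect P Phat C ε) s s' := by
  obtain ⟨t, h1, h2⟩ := h
  exact Progress.trans _ _ _ (h1.progress hG hd _)
    (h2.rel Progress.refl Progress.trans fun _ _ _ _ hr => hr.progress hG hP)

theorem Phase2.progress (hG : IsPolytree G) (hP : IsMarkov P G) (hd : maxInDegree G ≤ d)
    {s s' : State V} (h : Phase2 (skel G) d (C * ε) Phat s s') :
    Progress G (fun t => t.IsCorrect P Phat C ε) s s' := by
  induction h with
  | halt h _ => exact h.progress hG hP hd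
  | again h _ _ ih => exact Progress.trans _ _ _ (h.progress hG hP hd) ih

theorem Phase2.exists_last {K : SimpleGraph V} {τ : ℝ} {s s' : State V}
    (h : Phase2 K d τ Phat s s') : ∃ t, Phase2Iter K d τ Phat t s' ∧ s'.arcs = t.arcs := by
  induction h with
  | halt h h' => exact ⟨_, h, h'⟩
  | again _ _ _ ih => exact ih

theorem Phase1.exists_round (hG : IsPolytree G) (hP : IsMarkov P G) {k : ℕ} (hk : 2 ≤ k) :
    ∀ {γ : ℕ} {s s' : State V}, k ≤ γ → Phase1 (skel G) d (C * ε) Phat γ s s' →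
    ∃ t t', Progress G (fun t => t.IsCorrect P Phat C ε) s t ∧
      Phase1Round (skel G) d (C * ε) Phat k t t' ∧
      Progress G (fun t => t.IsCorrect P Phat C ε) t' s'
  | 0, _, _, hγ, _ => absurd hγ (by omega)
  | 1, _, _, hγ, _ => absurd hγ (by omega)
  | γ + 2, s, s', hγ, ⟨t, h1, h2⟩ => by
    rcases hγ.eq_or_lt with rfl | hγ
    · exact ⟨s, t, Progress.refl s, h1, h2.progress hG hP⟩
    · obtain ⟨r, r', h3, h4, h5⟩ := Phase1.exists_round hG hP hk (γ := γ + 1) (by omega) h2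
      exact ⟨r, r', Progress.trans _ _ _ (h1.progress hG hP) h3, h4, h5⟩

/-- After the first phase, a set of at least two parents of `v` either has been oriented into `v`,
or contains a parent that is nearly independent of the others given `v`. -/
theorem Phase1.dichotomy (hG : IsPolytree G) (hP : IsMarkov P G) (hd : maxInDegree G ≤ d)
    {s : State V} (h : Phase1 (skel G) d (C * ε) Phat d ⟨∅, ∅⟩ s)
    (hok : ∀ t ∈ s.tests, t.IsCorrect P Phat C ε) {v : V} {T : Finset V}
    (hT : T ⊆ parents G v) (hcard : 2 ≤ T.card) :
    (∀ u ∈ T, (u, v) ∈ s.arcs) ∨ ∃ u ∈ T, condSetInfo P {u} (T \ {u}) v < ε := by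
  have hle := ((Finset.card_le_card hT).trans (card_parents_le G v)).trans hd
  have hTn : T ⊆ nbrs (skel G) v := fun u hu =>
    mem_nbrs.2 (hG.skel_adj.2 (.inr (mem_parents.1 (hT hu))))
  obtain ⟨r, r', h1, h2, h3⟩ := h.exists_round hG hP hcard hle
  obtain ⟨p, p', h4, h5, h6⟩ := ForEach.exists_step Progress.refl Progress.trans
    (fun v _ _ _ h' => h'.rel Progress.refl Progress.trans fun _ hT r _ hr =>
      hr ▸ strongCheck_progress hG hP v (Finset.mem_powersetCard.1 hT).1 r) h2
    (Finset.mem_univ v)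
  obtain ⟨q, q', h7, h8, h9⟩ := ForEach.exists_step Progress.refl Progress.trans
    (fun _ hT r _ hr => hr ▸ strongCheck_progress hG hP v (Finset.mem_powersetCard.1 hT).1 r) h5
    (Finset.mem_powersetCard.2 ⟨hTn, rfl⟩)
  have hpre := Progress.trans _ _ _ (Progress.trans _ _ _ h1 h4) h7
  have hpost := Progress.trans _ _ _ (Progress.trans _ _ _ h9 h6) h3
  have hq := Progress.trans _ _ _ (h8 ▸ strongCheck_progress hG hP v hTn q) hpost
  have hsound : Sound G q.arcs := hpre.sound (fun t ht => hok t (hq.tests ht))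
    (fun e he => absurd he (Finset.notMem_empty e))
  -- When T comes up, both T and the incoming neighbours found so far are true parents, so the size
  -- guard cannot block the test.
  have hcard' : (T ∪ nIn (skel G) q.arcs v).card ≤ d :=
    (Finset.card_le_card (Finset.union_subset hT (hsound.nIn_subset v))).trans
      ((card_parents_le G v).trans hd)
  rw [strongCheck, if_pos hcard'] at h8
  by_cases hall : ∀ u ∈ T, C * ε ≤ Test.info ⟨{u}, T \ {u}, some v⟩ Phat
  · left
    intro u hu
    apply hpost.arcs
    rw [h8, if_pos hall, mem_orientInto]
    by_cases huv : (u, v) ∈ q.arcs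
    · exact .inl huv
    · exact .inr ⟨⟨hu, mem_nUn.2 ⟨mem_nbrs.1 (hTn hu), huv, fun hvu =>
        hG.not_adj_symm (mem_parents.1 (hT hu)) (hsound _ hvu)⟩⟩, rfl⟩
  · right
    push Not at hall
    obtain ⟨u, hu, hlt⟩ := hall
    refine ⟨u, hu, (hok _ (hpost.tests ?_)).2 hlt.le⟩
    rw [h8]
    exact .inr ⟨u, hu, rfl⟩

/-- After the second phase, an unoriented neighbour of `v` is nearly independent of the parents
of `v` known so far, if there are any. -/
theorem Phase2.setInfo_lt (hG : IsPolytree G) (hP : IsMarkov P G) (hd : maxInDegree G ≤ d)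
    {s s' : State V} (h : Phase2 (skel G) d (C * ε) Phat s s')
    (hok : ∀ t ∈ s'.tests, t.IsCorrect P Phat C ε) (hs : Sound G s'.arcs) {u v : V}
    (hu : u ∈ nUn (skel G) s'.arcs v) (hv : (nIn (skel G) s'.arcs v).Nonempty) :
    setInfo P {u} (nIn (skel G) s'.arcs v) < ε := by
  obtain ⟨t, ⟨t', hM, hL⟩, harcs⟩ := h.exists_last
  have hL' := hL.rel Progress.refl Progress.trans fun _ _ _ _ hr =>
    LocalSearch.progress hG hP hr
  -- The last iteration orients nothing and arcs only grow, so all its intermediate states carry the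
  -- final arcs.
  have ht' : t'.arcs = s'.arcs :=
    subset_antisymm hL'.arcs (harcs ▸ (hM.progress hG hd (fun _ => True)).arcs)
  -- With d incoming arcs and an open edge at v, the Meek step of the last iteration would have
  -- added an arc.
  have hne : (nIn (skel G) s'.arcs v).card ≠ d := by
    intro hcard
    rcases hM with ⟨w, hw, ⟨x, hx⟩, rfl⟩ | ⟨hno, -⟩
    · have : (w, x) ∈ orientAway (skel G) t.arcs w (nUn (skel G) t.arcs w) :=
        mem_orientAway.2 (.inr ⟨rfl, hx, hx⟩)
      dsimp only at ht'
      rw [ht', harcs] at this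
      exact (mem_nUn.1 hx).2.2 this
    · rw [← harcs] at hno
      exact hno ⟨v, hcard, u, hu⟩
  have hlt : (nIn (skel G) s'.arcs v).card < d := ((hs.card_nIn_le v).trans hd).lt_of_ne hne
  obtain ⟨r, r', h1, h2, h3⟩ := ForEach.exists_step Progress.refl Progress.trans
    (fun _ _ _ _ hr => LocalSearch.progress hG hP hr) hL (Finset.mem_univ v)
  have h2' := h2.progress hG hP
  have hr : r.arcs = s'.arcs :=
    subset_antisymm (h2'.arcs.trans h3.arcs) (ht' ▸ h1.arcs)
  rw [LocalSearch, hr, if_pos ⟨hv.card_pos, hlt⟩] at h2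
  have hstep : ∀ u ∈ nUn (skel G) s'.arcs v, ∀ q q' : State V,
      (q' = localCheck (skel G) (C * ε) Phat v u q ∨
        (d ≤ (nIn (skel G) q.arcs v).card ∧ q' = q)) →
      Progress G (fun t => t.IsCorrect P Phat C ε) q q' := by
    rintro u - q q' (rfl | ⟨-, rfl⟩)
    · exact localCheck_progress hG hP v u q
    · exact Progress.refl q'
  obtain ⟨q, q', h4, h5, h6⟩ := h2.exists_step Progress.refl Progress.trans hstep hu
  have h5' := hstep u hu q q' h5
  have hq' : q'.arcs ⊆ s'.arcs := h6.arcs.trans h3.arcs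
  have hq : q.arcs = s'.arcs := subset_antisymm (h5'.arcs.trans hq') (hr ▸ h4.arcs)
  -- Either positive outcome of the check would orient the edge between u and v, which is still open
  -- at the end; so both tests failed. Skipping is excluded by `hlt`.
  rcases h5 with rfl | ⟨hge, -⟩
  · have hun := mem_nUn.1 hu
    unfold localCheck at hq' h6
    dsimp only at hq' h6
    rw [hq] at hq' h6
    split_ifs at hq' h6 with c1 c2
    · exact absurd (hq' (mem_orientInto.2 (.inr ⟨⟨Finset.mem_singleton_self u, hu⟩, rfl⟩)))
        hun.2.1
    · exact absurd (hq' (mem_orientAway.2 (.inr ⟨rfl, Finset.mem_singleton_self u, hu⟩)))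
        hun.2.2
    · exact (hok _ (h3.tests (h6.tests (.inr (.inr rfl))))).2 (not_lt.1 c2)
  · rw [hq] at hge
    exact absurd hlt hge.not_gt

end Algorithm

/-! ### Orientation-independent sums over edges. -/

section Orientations

variable {V : Type*} [Fintype V]

/-- The sum of a symmetric function over the edges does not depend on their orientation. -/
theorem sum_parents_eq_of_skel_eq {D D' : Digraph V} (hD : ∀ u v, D.Adj u v → ¬ D.Adj v u)
    (hD' : ∀ u v, D'.Adj u v → ¬ D'.Adj v u) (hskel : skel D = skel D') {f : V → V → ℝ}
    (hf : ∀ u v, f u v = f v u) :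
    ∑ v, ∑ u ∈ parents D v, f u v = ∑ v, ∑ u ∈ parents D' v, f u v := by
  classical
  -- Twice the sum over arcs is the sum over ordered adjacent pairs of the skeleton, which no longer
  -- sees the orientation.
  have key : ∀ E : Digraph V, (∀ u v, E.Adj u v → ¬ E.Adj v u) →
      2 * ∑ v, ∑ u ∈ parents E v, f u v =
        ∑ v, ∑ u, if (skel E).Adj u v then f u v else 0 := by
    intro E hE
    have e1 : ∑ v, ∑ u ∈ parents E v, f u v = ∑ v, ∑ u, if E.Adj u v then f u v else 0 := by
      simp_rw [parents, Finset.sum_filter]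
    have e2 : ∑ v, ∑ u ∈ parents E v, f u v = ∑ v, ∑ u, if E.Adj v u then f u v else 0 := by
      rw [e1, Finset.sum_comm]
      simp_rw [hf]
    rw [two_mul]
    nth_rewrite 1 [e1]
    rw [e2, ← Finset.sum_add_distrib]
    refine Finset.sum_congr rfl fun v _ => ?_
    rw [← Finset.sum_add_distrib]
    refine Finset.sum_congr rfl fun u _ => ?_
    have h1 := hE u v
    have h2 : (skel E).Adj u v ↔ E.Adj u v ∨ E.Adj v u := by
      rw [skel_adj, and_iff_right_iff_imp]
      rintro h rfl
      exact hE u u (h.elim id id) (h.elim id id)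
    by_cases c1 : E.Adj u v <;> by_cases c2 : E.Adj v u <;> simp_all
  have h1 := key D hD
  have h2 := key D' hD'
  rw [hskel] at h1
  linarith

end Orientations

/-! ### Information beyond the pairwise terms, and the cost of missing or extra parents. -/

section Excess

variable {V α : Type*} [Fintype V] [DecidableEq V] [Fintype α]
  {P : PMF (V → α)} {G : Digraph V} {ε : ℝ}

theorem setInfo_comm (P : PMF (V → α)) (S T : Finset V) : setInfo P S T = setInfo P T S := by
  rw [setInfo_eq, setInfo_eq, Finset.union_comm]
  ring

theorem setInfo_empty_right (P : PMF (V → α)) (S : Finset V) : setInfo P S ∅ = 0 := by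
  rw [setInfo_eq, Finset.union_empty, entropy_empty]
  ring

/-- The part of `I(v;T)` that is not accounted for by the pairwise informations `I(u;v)`. -/
noncomputable def excess (P : PMF (V → α)) (v : V) (T : Finset V) : ℝ :=
  setInfo P {v} T - ∑ u ∈ T, setInfo P {u} {v}

theorem excess_empty (P : PMF (V → α)) (v : V) : excess P v ∅ = 0 := by
  simp [excess, setInfo_empty_right]

/-- The chain rule gives I(v;T∪u) = I(v;T) + I(u;v) + I(u;T|v) − I(u;T), and the last term vanishes
for parents. -/
theorem excess_insert (hG : IsPolytree G) (hP : IsMarkov P G) {u v : V} {T : Finset V}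
    (hu : G.Adj u v) (hT : T ⊆ parents G v) (huT : u ∉ T) :
    excess P v (insert u T) = excess P v T + condSetInfo P {u} T v := by
  have h := setInfo_parents_eq_zero hG hP hu hT huT
  rw [excess, excess, Finset.sum_insert huT, condSetInfo_eq]
  simp only [setInfo_eq, Finset.singleton_union] at h ⊢
  rw [Finset.pair_comm v u]
  linarith

theorem excess_mono (hG : IsPolytree G) (hP : IsMarkov P G) {v : V} {S T : Finset V}
    (hST : S ⊆ T) (hT : T ⊆ parents G v) : excess P v S ≤ excess P v T := by
  induction hn : (T \ S).card generalizing T with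
  | zero =>
    rw [Finset.card_eq_zero, Finset.sdiff_eq_empty_iff_subset] at hn
    rw [subset_antisymm hST hn]
  | succ n ih =>
    obtain ⟨u, hu⟩ : (T \ S).Nonempty := Finset.card_pos.1 (by omega)
    obtain ⟨huT, huS⟩ := Finset.mem_sdiff.1 hu
    have hsub := (Finset.erase_subset u T).trans hT
    have h1 := ih (T := T.erase u) (Finset.subset_erase.2 ⟨hST, huS⟩) hsub (by
      rw [Finset.erase_sdiff_comm, Finset.card_erase_of_mem hu, hn]
      rfl)
    have h2 := excess_insert hG hP (mem_parents.1 (hT huT)) hsub (Finset.notMem_erase u T)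
    rw [Finset.insert_erase huT] at h2
    linarith [condSetInfo_nonneg P {u} (T.erase u) v]

/-- Peeling off nearly independent parents one by one. -/
theorem excess_le (hG : IsPolytree G) (hP : IsMarkov P G) (hε : 0 < ε) {v : V} {N : Finset V}
    (hN : N ⊆ parents G v)
    (hpeel : ∀ T ⊆ parents G v, 2 ≤ T.card → T ⊆ N ∨ ∃ u ∈ T, condSetInfo P {u} (T \ {u}) v < ε)
    {T : Finset V} (hT : T ⊆ parents G v) : excess P v T ≤ excess P v N + T.card * ε := by
  have hN0 := excess_mono hG hP (Finset.empty_subset N) hN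
  rw [excess_empty] at hN0
  induction hn : T.card generalizing T with
  | zero =>
    rw [Finset.card_eq_zero] at hn
    simpa [hn, excess_empty] using hN0
  | succ n ih =>
    have hnε : 0 ≤ ((n + 1 : ℕ) : ℝ) * ε := by positivity
    -- A single parent has excess zero, which is why rounds of size at least two suffice.
    rcases n.eq_zero_or_pos with rfl | hpos
    · obtain ⟨u, rfl⟩ := Finset.card_eq_one.1 hn
      rw [excess, Finset.sum_singleton, setInfo_comm P {v}, sub_self]
      linarith
    · rcases hpeel T hT (by omega) with h | ⟨u, huT, hlt⟩
      · linarith [excess_mono hG hP h hN]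
      · have hsub : T \ {u} ⊆ parents G v := Finset.sdiff_subset.trans hT
        have h1 := ih (T := T \ {u}) hsub
          (by rw [Finset.sdiff_singleton_eq_erase, Finset.card_erase_of_mem huT, hn]; rfl)
        have h2 := excess_insert hG hP (mem_parents.1 (hT huT)) hsub (by simp)
        rw [Finset.sdiff_singleton_eq_erase, Finset.insert_erase huT,
          ← Finset.sdiff_singleton_eq_erase] at h2
        push_cast
        linarith

/-- The same identity as in `excess_insert`, now with I(w;N) < ε in place of 0; w need not be a true
parent. -/
theorem le_setInfo_insert (P : PMF (V → α)) {v w : V} {N : Finset V}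
    (h : setInfo P {w} N < ε) :
    setInfo P {v} N + setInfo P {w} {v} - ε ≤ setInfo P {v} (insert w N) := by
  have h0 := condSetInfo_nonneg P {w} N v
  rw [condSetInfo_eq] at h0
  simp only [setInfo_eq, Finset.singleton_union] at h h0 ⊢
  rw [Finset.pair_comm w v]
  linarith

end Excess

end PolytreeLearning

/-! ### The main theorem. -/

open PolytreeLearning
theorem mainTheorem3 {V α : Type*} [Fintype V] [DecidableEq V] [Fintype α]
    (G : Digraph V) (hG : IsPolytree G)
    (P : PMF (V → α)) (hP : IsMarkov P G)
    (d : ℕ) (hd : maxInDegree G ≤ d)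
    (ε C : ℝ) (hε : 0 < ε) (hC0 : 0 < C) (hC1 : C < 1)
    (m : ℕ) [NeZero m] (x : Fin m → V → α)
    (Ghat : Digraph V) (tests : Set (Test V))
    (hrun : IsOutput (skel G) d (C * ε) (empirical x) Ghat tests)
    (htests : ∀ t ∈ tests, t.IsCorrect P (empirical x) C ε) :
    (∑ v : V, setInfo P {v} (parents G v) - ∑ v : V, setInfo P {v} (parents Ghat v)
        ≤ (Fintype.card V : ℝ) * ((maxInDegree G : ℝ) + 1) * ε) ∧
      klDivergence (fun ω => (P ω).toReal) (projection P Ghat)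
        ≤ (((Fintype.card V : ℝ) * ((maxInDegree G : ℝ) + 1) * ε : ℝ) : EReal) := by
  obtain ⟨s₁, s₂, h1, h2, ⟨F, hF, hFskel, hFdeg, hGhat⟩, rfl⟩ := hrun
  have p2 := h2.progress hG hP hd
  have hok₁ : ∀ t ∈ s₁.tests, t.IsCorrect P (empirical x) C ε :=
    fun t ht => htests t (p2.tests ht)
  have hsound : Sound G s₂.arcs := p2.sound htests ((h1.progress hG hP).sound hok₁
    fun e he => absurd he (Finset.notMem_empty e))
  set N : V → Finset V := nIn (skel G) s₂.arcs with hNdef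
  have hN : ∀ v, N v ⊆ parents G v := hsound.nIn_subset
  have hF_nUn : ∀ u v, F.Adj u v → u ∈ nUn (skel G) s₂.arcs v := by
    intro u v huv
    have h : (unorientedGraph (skel G) s₂.arcs).Adj u v := hFskel ▸ hF.skel_adj.2 (.inl huv)
    rcases h.2 with h | h
    · exact h
    · have := mem_nUn.1 h
      exact mem_nUn.2 ⟨this.1.symm, this.2.2, this.2.1⟩
  have hpar : ∀ v, parents Ghat v = N v ∪ parents F v := by
    intro v
    ext u
    rw [Finset.mem_union, mem_parents, mem_parents, hGhat, hNdef, mem_nIn]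
    refine or_congr_left ⟨fun h => ⟨hG.skel_adj.2 (.inr (hsound _ h)), h⟩, And.right⟩
  -- The true orientation of the edges left open; it has the same skeleton as the Phase 3
  -- orientation `F`.
  let D : Digraph V := ⟨fun u v => G.Adj u v ∧ u ∈ nUn (skel G) s₂.arcs v⟩
  have hDpar : ∀ v, parents D v = parents G v \ N v := by
    intro v
    ext u
    rw [Finset.mem_sdiff, mem_parents, mem_parents, hNdef, mem_nIn]
    refine and_congr_right fun huv => ?_
    rw [mem_nUn]
    have h := hG.skel_adj.2 (.inr huv)
    have h' : (v, u) ∉ s₂.arcs := fun h' => hG.not_adj_symm huv (hsound _ h')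
    tauto
  have hedges : ∑ v, ∑ u ∈ parents G v \ N v, setInfo P {u} {v} =
      ∑ v, ∑ u ∈ parents F v, setInfo P {u} {v} := by
    simp_rw [← hDpar]
    refine sum_parents_eq_of_skel_eq (D := D) (fun u v h h' => hG.not_adj_symm h.1 h'.1)
      (fun u v h => hF.not_adj_symm h) ?_ fun u v => setInfo_comm P _ _
    rw [hFskel]
    ext u v
    change u ≠ v ∧ _ ↔ u ≠ v ∧ _
    have hsymm : v ∈ nUn (skel G) s₂.arcs u ↔ u ∈ nUn (skel G) s₂.arcs v := by
      rw [mem_nUn, mem_nUn, SimpleGraph.adj_comm]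
      tauto
    have hadj : u ∈ nUn (skel G) s₂.arcs v → G.Adj u v ∨ G.Adj v u :=
      fun h => (hG.skel_adj.1 (mem_nUn.1 h).1).symm
    change u ≠ v ∧ (G.Adj u v ∧ u ∈ nUn (skel G) s₂.arcs v ∨
      G.Adj v u ∧ v ∈ nUn (skel G) s₂.arcs u) ↔ _
    rw [hsymm]
    tauto
  have hpeel : ∀ v, excess P v (parents G v) ≤ excess P v (N v) + maxInDegree G * ε := by
    intro v
    refine (excess_le hG hP hε (hN v) (fun T hT hcard => ?_) subset_rfl).trans ?_
    · refine (h1.dichotomy hG hP hd hok₁ hT hcard).imp_left fun h u hu => mem_nIn.2 ?_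
      exact ⟨hG.skel_adj.2 (.inr (mem_parents.1 (hT hu))), p2.arcs (h u hu)⟩
    · have := card_parents_le G v
      gcongr
  have hfree : ∀ v, setInfo P {v} (N v) + ∑ u ∈ parents F v, setInfo P {u} {v} - ε ≤
      setInfo P {v} (parents Ghat v) := by
    intro v
    rw [hpar]
    rcases Nat.le_one_iff_eq_zero_or_eq_one.1 ((card_parents_le F v).trans hFdeg) with h | h
    · rw [Finset.card_eq_zero.1 h, Finset.union_empty, Finset.sum_empty]
      linarith
    · obtain ⟨w, hw⟩ := Finset.card_eq_one.1 h
      have hwv : F.Adj w v := mem_parents.1 (hw ▸ Finset.mem_singleton_self w)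
      rw [hw, Finset.sum_singleton, Finset.union_comm, Finset.singleton_union]
      refine le_setInfo_insert P ?_
      -- Phase 2 tests nothing at a vertex without known parents, but there I(w;∅) = 0 is below ε
      -- anyway.
      rcases (N v).eq_empty_or_nonempty with h0 | h0
      · rwa [h0, setInfo_empty_right]
      · exact h2.setInfo_lt hG hP hd htests hsound (hF_nUn w v hwv) h0
  have hmain : ∑ v : V, setInfo P {v} (parents G v) - ∑ v : V, setInfo P {v} (parents Ghat v)
      ≤ (Fintype.card V : ℝ) * ((maxInDegree G : ℝ) + 1) * ε := by
    -- The pairwise terms need not cancel at a single vertex, only after summation through `hedges`.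
    have hv : ∀ v, setInfo P {v} (parents G v) - setInfo P {v} (parents Ghat v) ≤
        (∑ u ∈ parents G v \ N v, setInfo P {u} {v} - ∑ u ∈ parents F v, setInfo P {u} {v}) +
          ((maxInDegree G : ℝ) + 1) * ε := by
      intro v
      have h := hpeel v
      rw [excess, excess, ← Finset.sum_sdiff (hN v)] at h
      linarith [hfree v]
    have hsum := Finset.sum_le_sum fun v (_ : v ∈ Finset.univ) => hv v
    rw [Finset.sum_add_distrib, Finset.sum_sub_distrib, Finset.sum_sub_distrib, hedges, sub_self,
      zero_add, Finset.sum_const, Finset.card_univ, nsmul_eq_mul, ← mul_assoc] at hsum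
    exact hsum
  refine ⟨hmain, ?_⟩
  -- The entropies H(v) cancel, so differences of conditional entropies become differences of mutual
  -- informations.
  rw [klDivergence_projection, hP.entropy_univ, EReal.coe_le_coe_iff]
  refine le_trans (le_of_eq ?_) hmain
  simp_rw [← Finset.sum_sub_distrib, parentEntropy, setInfo_eq, Finset.singleton_union]
  refine Finset.sum_congr rfl fun v _ => ?_
  ring
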